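/- Let $M$ be a smooth real manifold and let $J$ be a smooth almost complex structure on $M$, i.e. a $(1,1)$-tensor field with $J^2=-\mathrm{Id}$. On the cotangent bundle $\pi:T^*M\to M$ let $\theta$ be the Liouville form, $\theta_\xi(U)=\xi(d\pi\,U)$, and let $\omega=d\theta$ be the canonical symplectic form. Let $\theta(J)$ be the one-form $\theta(J)_\xi(U)=\xi(J\,d\pi\,U)$, and let $J^c$ be the endomorphism field of $T(T^*M)$ defined by $d(\theta(J))=\omega(J^c\cdot,\cdot)$. For a tensor $R$ of type $(1,2)$ on $M$ let $\gamma(R)$ be the endomorphism field of $T(T^*M)$ defined by $\omega(\gamma(R)U,V)=\xi(R(d\pi\,U,d\pi\,V))$ for $U,V\in T_\xi T^*M$; in local coordinates, $\gamma(R)=p_kR^k_{i,j}\,dx^i\otimes\partial_{p_j}$. Let $N_J(X,Y)=[JX,JY]-J[X,JY]-J[JX,Y]-[X,Y]$, and define the complete lift $$\widetilde J=J^c-\tfrac12\gamma(JN_J).$$ For a connection $\nabla$ on $M$ with torsion $T(X,Y)=\nabla_XY-\nabla_YX-[X,Y]$ put $\widetilde\nabla=\nabla-\frac12T$, $(\widetilde\nabla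 J)(X,Y)=\widetilde\nabla_X(JY)-J\widetilde\nabla_XY$, $[\widetilde\nabla J](X,Y)=-(\widetilde\nabla J)(X,Y)+(\widetilde\nabla J)(Y,X)$, and define the horizontal lift $$J^{H,\nabla}=J^c+\gamma([\widetilde\nabla J]).$$ Let $a,b\in\mathbb R$ with $b\neq0$ and let $Z:T^*M\to T^*M$, $Z(x,p)=(x,\,ap+b\,p\circ J(x))$, be the fiberwise multiplication by $a+ib$. For an endomorphism field $A$ of $T(T^*M)$, say that $Z$ is $A$-holomorphic if $Z$ is smooth and $A(Z(\xi))\circ d_\xi Z=d_\xi Z\circ A(\xi)$ for every $\xi\in T^*M$. Then: (1) $Z$ is $\widetilde J$-holomorphic. (2) For every connection $\nabla$ on $M$, $Z$ is $J^{H,\nabla}$-holomorphic if and only if $(\widetilde\nabla J)(JX,Y)=(\widetilde\nabla J)(X,JY)$ for all $x\in M$ and $X,Y\in T_xM$. -/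

import Mathlib

open Bundle Set VectorField
open scoped Manifold ContDiff Topology

namespace AlmostComplex

noncomputable section

/-! ### One-forms and holomorphic maps on a general manifold -/

section General

variable {F : Type*} [NormedAddCommGroup F] [NormedSpace ℝ F]
  {H : Type*} [TopologicalSpace H] (I : ModelWithCorners ℝ F H)
  {N : Type*} [TopologicalSpace N] [ChartedSpace H N]

/-- The coordinate expression of the one-form `α` in the preferred chart `φ` at `y`: the one-form
`(φ⁻¹)^* α` on the model vector space. -/
def oneFormInChart (α : ∀ y : N, TangentSpace I y →L[ℝ] ℝ) (y : N) (z : F) : F →L[ℝ] ℝ :=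
  (α ((extChartAt I y).symm z)).comp (mfderiv 𝓘(ℝ, F) I (extChartAt I y).symm z)

/-- The exterior derivative of a one-form `α` on a manifold without boundary:
`dα (U, V) = ∂_U (α V) - ∂_V (α U)` in the preferred chart at `y`. -/
def extDerivOneForm [I.Boundaryless] (α : ∀ y : N, TangentSpace I y →L[ℝ] ℝ) (y : N) :
    TangentSpace I y →L[ℝ] TangentSpace I y →L[ℝ] ℝ :=
  let φ := extChartAt I y
  let D : F →L[ℝ] F →L[ℝ] ℝ := fderiv ℝ (oneFormInChart I α y) (φ y)
  let A : F →L[ℝ] F := mfderiv I 𝓘(ℝ, F) φ y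
  ContinuousLinearMap.bilinearComp (E' := F) (F' := F) (D - D.flip) A A

variable {F' : Type*} [NormedAddCommGroup F'] [NormedSpace ℝ F']
  {H' : Type*} [TopologicalSpace H'] (I' : ModelWithCorners ℝ F' H')
  {N' : Type*} [TopologicalSpace N'] [ChartedSpace H' N']

/-- A smooth map `f` is `(J, J')`-holomorphic if `J' (f y) ∘ d_y f = d_y f ∘ J y` for all `y`. -/
def IsHolomorphic (J : ∀ y : N, TangentSpace I y →L[ℝ] TangentSpace I y)
    (J' : ∀ y : N', TangentSpace I' y →L[ℝ] TangentSpace I' y) (f : N → N') : Prop :=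
  ContMDiff I I' ∞ f ∧
    ∀ y : N, (J' (f y)).comp (mfderiv I I' f y) = (mfderiv I I' f y).comp (J y)

end General

theorem extDerivOneForm_eq {F : Type*} [NormedAddCommGroup F] [NormedSpace ℝ F]
    {H : Type*} [TopologicalSpace H] (I : ModelWithCorners ℝ F H) [I.Boundaryless]
    {N : Type*} [TopologicalSpace N] [ChartedSpace H N] [IsManifold I 1 N]
    {α : ∀ y : N, TangentSpace I y →L[ℝ] ℝ} {y : N} {D : F →L[ℝ] F →L[ℝ] ℝ}
    (h : HasFDerivAt (oneFormInChart I α y) D (extChartAt I y y)) (U V : F) :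
    extDerivOneForm I α y U V = D U V - D V U := by
  have hA : (mfderiv I 𝓘(ℝ, F) (extChartAt I y) y : F →L[ℝ] F) = ContinuousLinearMap.id ℝ F :=
    mfderiv_extChartAt_self
  have e : extDerivOneForm I α y U V =
    fderiv ℝ (oneFormInChart I α y) (extChartAt I y y)
      ((mfderiv I 𝓘(ℝ, F) (extChartAt I y) y : F →L[ℝ] F) U)
      ((mfderiv I 𝓘(ℝ, F) (extChartAt I y) y : F →L[ℝ] F) V) -
    fderiv ℝ (oneFormInChart I α y) (extChartAt I y y)
      ((mfderiv I 𝓘(ℝ, F) (extChartAt I y) y : F →L[ℝ] F) V)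
      ((mfderiv I 𝓘(ℝ, F) (extChartAt I y) y : F →L[ℝ] F) U) := rfl
  rw [e, h.fderiv]
  erw [hA]
  rfl

theorem extDerivOneForm_eq_of_eventuallyEq {F : Type*} [NormedAddCommGroup F] [NormedSpace ℝ F]
    {H : Type*} [TopologicalSpace H] (I : ModelWithCorners ℝ F H) [I.Boundaryless]
    {N : Type*} [TopologicalSpace N] [ChartedSpace H N] [IsManifold I 1 N]
    {α : ∀ y : N, TangentSpace I y →L[ℝ] ℝ} {y : N} {D : F →L[ℝ] F →L[ℝ] ℝ}
    (h : oneFormInChart I α y =ᶠ[𝓝 (extChartAt I y y)] D) (U V : F) :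
    extDerivOneForm I α y U V = D U V - D V U :=
  extDerivOneForm_eq I (D.hasFDerivAt.congr_of_eventuallyEq h) U V

theorem isInvertible_of_nondegenerate {F : Type*} [NormedAddCommGroup F] [NormedSpace ℝ F]
    [FiniteDimensional ℝ F] (L : F →L[ℝ] F →L[ℝ] ℝ) (hL : ∀ U, (∀ V, L U V = 0) → U = 0) :
    L.IsInvertible := by
  have hinj : Function.Injective (L : F →ₗ[ℝ] F →L[ℝ] ℝ) := by
    rw [← LinearMap.ker_eq_bot, LinearMap.ker_eq_bot']
    exact fun U hU => hL U fun V => congrArg (fun A : F →L[ℝ] ℝ => A V) hU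
  have hdim : Module.finrank ℝ F = Module.finrank ℝ (F →L[ℝ] ℝ) := by
    rw [← (LinearMap.toContinuousLinearMap (𝕜 := ℝ) (E := F) (F' := ℝ)).finrank_eq]
    exact (Subspace.dual_finrank_eq (K := ℝ) (V := F)).symm
  exact ⟨(LinearEquiv.ofInjectiveOfFinrankEq (L : F →ₗ[ℝ] F →L[ℝ] ℝ) hinj
    hdim).toContinuousLinearEquiv, by ext U; rfl⟩

variable {E : Type*} [NormedAddCommGroup E] [NormedSpace ℝ E]
  {M : Type*} [TopologicalSpace M] [ChartedSpace E M] [IsManifold 𝓘(ℝ, E) ∞ M]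

variable (E M) in
/-- A (smooth) almost complex structure on `M`: a smooth `(1,1)`-tensor field `J`
with `J² = -Id`. -/
structure AlmostComplexStructure where
  /-- The endomorphism of each tangent space. -/
  toFun : ∀ x : M, TangentSpace 𝓘(ℝ, E) x →L[ℝ] TangentSpace 𝓘(ℝ, E) x
  contMDiff_toFun : ContMDiff 𝓘(ℝ, E) (𝓘(ℝ, E).prod 𝓘(ℝ, E →L[ℝ] E)) ∞
    (fun x => TotalSpace.mk' (E →L[ℝ] E)
      (E := fun x : M => TangentSpace 𝓘(ℝ, E) x →L[ℝ] TangentSpace 𝓘(ℝ, E) x) x (toFun x))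
  sq_eq_neg : ∀ (x : M) (X : TangentSpace 𝓘(ℝ, E) x), toFun x (toFun x X) = -X

instance : CoeFun (AlmostComplexStructure E M)
    (fun _ => ∀ x : M, TangentSpace 𝓘(ℝ, E) x →L[ℝ] TangentSpace 𝓘(ℝ, E) x) :=
  ⟨AlmostComplexStructure.toFun⟩

/-! ### The tensors `N_J` and `∇J` -/

/-- The vector field `J X`. -/
def AlmostComplexStructure.mulField (J : AlmostComplexStructure E M)
    (X : ∀ x : M, TangentSpace 𝓘(ℝ, E) x) : ∀ x : M, TangentSpace 𝓘(ℝ, E) x :=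
  fun x => J x (X x)

theorem AlmostComplexStructure.mdifferentiableAt_mulField (J : AlmostComplexStructure E M)
    {X : ∀ x : M, TangentSpace 𝓘(ℝ, E) x} {x : M} (hX : MDiffAt (T% X) x) :
    MDiffAt (T% (J.mulField X)) x :=
  MDifferentiableAt.clm_bundle_apply (b := fun x : M => x)
    (J.contMDiff_toFun.mdifferentiable (by simp) x) hX

theorem AlmostComplexStructure.mulField_add (J : AlmostComplexStructure E M)
    (X Y : ∀ x : M, TangentSpace 𝓘(ℝ, E) x) :
    J.mulField (X + Y) = J.mulField X + J.mulField Y := by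
  funext x
  simp [mulField]

theorem AlmostComplexStructure.mulField_smul (J : AlmostComplexStructure E M) (f : M → ℝ)
    (X : ∀ x : M, TangentSpace 𝓘(ℝ, E) x) :
    J.mulField (f • X) = f • J.mulField X := by
  funext x
  simp [mulField]

/-- `∇_X (J Y) - J ∇_X Y`, on vector fields `Y`, as a linear function of the vector `X`. -/
def nablaJAux (cov : CovariantDerivative 𝓘(ℝ, E) E (TangentSpace 𝓘(ℝ, E) : M → Type _))
    (J : AlmostComplexStructure E M) (Y : ∀ x : M, TangentSpace 𝓘(ℝ, E) x) (x : M) :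
    TangentSpace 𝓘(ℝ, E) x →L[ℝ] TangentSpace 𝓘(ℝ, E) x :=
  cov (J.mulField Y) x - (J x).comp (cov Y x)

theorem nablaJAux_tensorial
    (cov : CovariantDerivative 𝓘(ℝ, E) E (TangentSpace 𝓘(ℝ, E) : M → Type _))
    (J : AlmostComplexStructure E M) (x : M) :
    TensorialAt 𝓘(ℝ, E) E (fun Y => nablaJAux cov J Y x) x where
  smul hf hY := by
    have hcov := cov.isCovariantDerivativeOnUniv
    ext v
    simp [nablaJAux, J.mulField_smul, hcov.leibniz hY hf,
      hcov.leibniz (J.mdifferentiableAt_mulField hY) hf]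
    simp [AlmostComplexStructure.mulField]
    module
  add hY hY' := by
    have hcov := cov.isCovariantDerivativeOnUniv
    ext v
    simp [nablaJAux, J.mulField_add, hcov.add hY hY',
      hcov.add (J.mdifferentiableAt_mulField hY) (J.mdifferentiableAt_mulField hY')]
    module

/-! ### The cotangent bundle -/

variable (E M) in
/-- The cotangent bundle `T^*M`; its points are pairs `⟨x, p⟩` with `p` a covector at `x`. -/
abbrev CotangentBundle : Type _ :=
  TotalSpace (E →L[ℝ] ℝ) (fun x : M => TangentSpace 𝓘(ℝ, E) x →L[ℝ] ℝ)

variable (E) in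
/-- The model of the manifold `T^*M`. -/
abbrev cotangentModel : ModelWithCorners ℝ (E × (E →L[ℝ] ℝ)) (ModelProd E (E →L[ℝ] ℝ)) :=
  𝓘(ℝ, E).prod 𝓘(ℝ, E →L[ℝ] ℝ)

/-- The differential at `ξ` of the projection `π : T^*M → M`. -/
def dproj (ξ : CotangentBundle E M) :
    TangentSpace (cotangentModel E) ξ →L[ℝ] TangentSpace 𝓘(ℝ, E) ξ.proj :=
  mfderiv (cotangentModel E) 𝓘(ℝ, E) (fun η : CotangentBundle E M => η.proj) ξ

variable (E M) in
/-- The Liouville form `θ`: `θ_ξ (U) = ξ (dπ U)`. -/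
def liouville (ξ : CotangentBundle E M) : TangentSpace (cotangentModel E) ξ →L[ℝ] ℝ :=
  ξ.snd.comp (dproj ξ)

/-- The one-form `θ(J)`: `θ(J)_ξ (U) = ξ (J (dπ U))`. -/
def thetaJ (J : AlmostComplexStructure E M) (ξ : CotangentBundle E M) :
    TangentSpace (cotangentModel E) ξ →L[ℝ] ℝ :=
  ξ.snd.comp ((J ξ.proj).comp (dproj ξ))

/-- The two-form `θ(R)` for a `(1,2)`-tensor `R`: `θ(R)_ξ (U, V) = ξ (R (dπ U, dπ V))`. -/
def thetaTensor
    (R : ∀ x : M, TangentSpace 𝓘(ℝ, E) x →L[ℝ] TangentSpace 𝓘(ℝ, E) x →L[ℝ] TangentSpace 𝓘(ℝ, E) x)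
    (ξ : CotangentBundle E M) :
    TangentSpace (cotangentModel E) ξ →L[ℝ] TangentSpace (cotangentModel E) ξ →L[ℝ] ℝ :=
  let P : E × (E →L[ℝ] ℝ) →L[ℝ] E := dproj ξ
  let B : E →L[ℝ] E →L[ℝ] ℝ := (ContinuousLinearMap.compL ℝ E E ℝ ξ.snd).comp (R ξ.proj)
  ContinuousLinearMap.bilinearComp (E' := E × (E →L[ℝ] ℝ)) (F' := E × (E →L[ℝ] ℝ)) B P P

variable (E M) in
/-- The canonical symplectic form `ω = dθ` of `T^*M`, as the map `U ↦ ω (U, ·)`. -/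
def canonicalForm (ξ : CotangentBundle E M) :
    TangentSpace (cotangentModel E) ξ →L[ℝ] TangentSpace (cotangentModel E) ξ →L[ℝ] ℝ :=
  extDerivOneForm (cotangentModel E) (liouville E M) ξ

theorem oneFormInChart_liouville (ξ : CotangentBundle E M) {z : E × (E →L[ℝ] ℝ)}
    (hz : z ∈ (extChartAt (cotangentModel E) ξ).target) (U : E × (E →L[ℝ] ℝ)) :
    oneFormInChart (cotangentModel E) (liouville E M) ξ z U = z.2 U.1 := by
  set φ := extChartAt (cotangentModel E) ξ with hφ
  set ψ := extChartAt 𝓘(ℝ, E) ξ.proj with hψ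
  have hsym : MDifferentiableAt 𝓘(ℝ, E × (E →L[ℝ] ℝ)) (cotangentModel E) φ.symm z := by
    have := mdifferentiableWithinAt_extChartAt_symm (I := cotangentModel E) hz
    rwa [ModelWithCorners.range_eq_univ, mdifferentiableWithinAt_univ] at this
  have hpm : ContMDiff (cotangentModel E) 𝓘(ℝ, E) 1
      (fun η : CotangentBundle E M => η.proj) :=
    Bundle.contMDiff_proj (fun x : M => TangentSpace 𝓘(ℝ, E) x →L[ℝ] ℝ)
  have hp := hpm.mdifferentiable one_ne_zero (φ.symm z)
  have hzψ : z.1 ∈ ψ.target := by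
    have h := hz
    rw [hφ, FiberBundle.extChartAt_target] at h
    exact h.1.1
  have hsymψ : MDifferentiableAt 𝓘(ℝ, E) 𝓘(ℝ, E) ψ.symm z.1 := by
    have := mdifferentiableWithinAt_extChartAt_symm (I := 𝓘(ℝ, E)) hzψ
    rwa [ModelWithCorners.range_eq_univ, mdifferentiableWithinAt_univ] at this
  have hproj : ∀ w ∈ φ.target, (φ.symm w).proj = ψ.symm w.1 := by
    intro w hw
    have h := hw
    rw [hφ, FiberBundle.extChartAt_target] at h
    rw [hφ, FiberBundle.extChartAt]
    exact Trivialization.proj_symm_apply' (trivializationAt (E →L[ℝ] ℝ)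
      (fun x : M => TangentSpace 𝓘(ℝ, E) x →L[ℝ] ℝ) ξ.proj) h.1.2
  have hopen : IsOpen φ.target := isOpen_extChartAt_target ξ
  have hcomp : (fun w => (φ.symm w).proj) =ᶠ[𝓝 z] (fun w => ψ.symm w.1) := by
    filter_upwards [hopen.mem_nhds hz] with w hw using hproj w hw
  have hd : HasMFDerivAt 𝓘(ℝ, E × (E →L[ℝ] ℝ)) 𝓘(ℝ, E) (fun w => (φ.symm w).proj) z
      ((dproj (φ.symm z)).comp (mfderiv 𝓘(ℝ, E × (E →L[ℝ] ℝ)) (cotangentModel E) φ.symm z)) :=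
    HasMFDerivAt.comp (g := fun η : CotangentBundle E M => η.proj) z hp.hasMFDerivAt hsym.hasMFDerivAt
  have hd2 : HasMFDerivAt 𝓘(ℝ, E × (E →L[ℝ] ℝ)) 𝓘(ℝ, E) (fun w : E × (E →L[ℝ] ℝ) => ψ.symm w.1) z
      ((mfderiv 𝓘(ℝ, E) 𝓘(ℝ, E) ψ.symm z.1).comp (ContinuousLinearMap.fst ℝ E (E →L[ℝ] ℝ))) := by
    refine HasMFDerivAt.comp (g := ψ.symm) (f := fun w : E × (E →L[ℝ] ℝ) => w.1) z
      hsymψ.hasMFDerivAt ?_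
    exact (ContinuousLinearMap.fst ℝ E (E →L[ℝ] ℝ)).hasFDerivAt.hasMFDerivAt
  have hd3 := hasMFDerivAt_unique (hd2.congr_of_eventuallyEq hcomp) hd
  have hη : φ.symm z ∈ φ.source := φ.map_target hz
  have hηz : φ (φ.symm z) = z := φ.right_inv hz
  have hzψ' : ψ.symm z.1 ∈ (chartAt E ξ.proj).source := by
    have := ψ.map_target hzψ
    rwa [hψ, extChartAt_source] at this
  have hproj' : (φ.symm z).proj ∈ (chartAt E ξ.proj).source := by
    rw [hproj z hz]; exact hzψ'
  have h2 : z.2 U.1 = (φ.symm z).snd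
      ((trivializationAt E (TangentSpace 𝓘(ℝ, E) : M → Type _) ξ.proj).symmL ℝ (φ.symm z).proj U.1) := by
    conv_lhs => rw [← hηz]
    rw [hφ, FiberBundle.extChartAt]
    change ContinuousLinearMap.inCoordinates E (TangentSpace 𝓘(ℝ, E) : M → Type _) ℝ
      (fun _ : M => ℝ) ξ.proj (φ.symm z).proj ξ.proj (φ.symm z).proj (φ.symm z).snd U.1 = _
    unfold ContinuousLinearMap.inCoordinates
    rw [ContinuousLinearMap.comp_apply, ContinuousLinearMap.comp_apply]
    exact congrArg (fun L : ℝ →ₗ[ℝ] ℝ => L _)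
      (Bundle.Trivial.linearMapAt_trivialization ℝ M ℝ (φ.symm z).proj)
  rw [h2, TangentBundle.symmL_trivializationAt hproj']
  have h3 : extChartAt 𝓘(ℝ, E) ξ.proj (φ.symm z).proj = z.1 := by
    rw [hproj z hz]; exact ψ.right_inv hzψ
  rw [h3, ModelWithCorners.range_eq_univ, mfderivWithin_univ]
  have h4 := congrArg (fun L : E × (E →L[ℝ] ℝ) →L[ℝ] E => L U) hd3
  exact congrArg (fun v : E => (φ.symm z).snd v) h4.symm

/-- The canonical form in coordinates, `ω = dp_i ∧ dx^i`. -/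
theorem canonicalForm_apply (ξ : CotangentBundle E M) (U V : E × (E →L[ℝ] ℝ)) :
    canonicalForm E M ξ U V = U.2 V.1 - V.2 U.1 := by
  have hz := mem_extChartAt_target (I := cotangentModel E) ξ
  let D₀ : E × (E →L[ℝ] ℝ) →L[ℝ] E × (E →L[ℝ] ℝ) →L[ℝ] ℝ :=
    (ContinuousLinearMap.precomp ℝ (ContinuousLinearMap.fst ℝ E (E →L[ℝ] ℝ))).comp
      (ContinuousLinearMap.snd ℝ E (E →L[ℝ] ℝ))
  have hev : oneFormInChart (cotangentModel E) (liouville E M) ξ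
      =ᶠ[𝓝 (extChartAt (cotangentModel E) ξ ξ)] D₀ := by
    filter_upwards [(isOpen_extChartAt_target ξ).mem_nhds hz] with z hz
    refine ContinuousLinearMap.ext fun U => ?_
    rw [oneFormInChart_liouville ξ hz]
    rfl
  exact extDerivOneForm_eq_of_eventuallyEq (cotangentModel E) hev U V

/-- The canonical symplectic form is nondegenerate. -/
theorem canonicalForm_isInvertible [FiniteDimensional ℝ E] (ξ : CotangentBundle E M) :
    (canonicalForm E M ξ).IsInvertible := by
  refine isInvertible_of_nondegenerate (F := E × (E →L[ℝ] ℝ)) (canonicalForm E M ξ) fun U h => ?_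
  have h' : ∀ V : E × (E →L[ℝ] ℝ), U.2 V.1 - V.2 U.1 = 0 := fun V => by
    rw [← canonicalForm_apply ξ U V]
    exact h V
  refine Prod.ext ?_ ?_
  · by_contra hne
    obtain ⟨f, hf⟩ := SeparatingDual.exists_ne_zero (R := ℝ) hne
    have := h' (0, f)
    simp at this
    exact hf this
  · ext v
    simpa using h' (v, 0)

/-- For a bilinear form `β` on the tangent spaces of `T^*M`, the endomorphism field `A` given by
`β (U, V) = ω (A U, V)`. -/
def sharpForm
    (β : ∀ ξ : CotangentBundle E M,
      TangentSpace (cotangentModel E) ξ →L[ℝ] TangentSpace (cotangentModel E) ξ →L[ℝ] ℝ)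
    (ξ : CotangentBundle E M) :
    TangentSpace (cotangentModel E) ξ →L[ℝ] TangentSpace (cotangentModel E) ξ :=
  (canonicalForm E M ξ).inverse.comp (β ξ)

/-- The endomorphism `sharpForm β` satisfies `ω (sharpForm β U, V) = β (U, V)`. -/
theorem canonicalForm_sharpForm [FiniteDimensional ℝ E]
    (β : ∀ ξ : CotangentBundle E M,
      TangentSpace (cotangentModel E) ξ →L[ℝ] TangentSpace (cotangentModel E) ξ →L[ℝ] ℝ)
    (ξ : CotangentBundle E M) (U V : TangentSpace (cotangentModel E) ξ) :
    canonicalForm E M ξ (sharpForm β ξ U) V = β ξ U V := by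
  obtain ⟨e, he⟩ := canonicalForm_isInvertible ξ
  unfold sharpForm
  rw [← he, ContinuousLinearMap.inverse_equiv]
  exact congrArg (fun A : TangentSpace (cotangentModel E) ξ →L[ℝ] ℝ => A V)
    (e.apply_symm_apply (β ξ U))

/-- The lift `J^c`, given by `d(θ(J)) = ω (J^c ·, ·)`. -/
def liftC (J : AlmostComplexStructure E M) (ξ : CotangentBundle E M) :
    TangentSpace (cotangentModel E) ξ →L[ℝ] TangentSpace (cotangentModel E) ξ :=
  sharpForm (extDerivOneForm (cotangentModel E) (thetaJ J)) ξ

/-- The contraction `γ(R)` of a `(1,2)`-tensor `R`, given by `θ(R) = ω (γ(R) ·, ·)`; in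
coordinates `γ(R) = p_k R_{ij}^k dx^i ⊗ ∂p_j`. -/
def contraction
    (R : ∀ x : M, TangentSpace 𝓘(ℝ, E) x →L[ℝ] TangentSpace 𝓘(ℝ, E) x →L[ℝ] TangentSpace 𝓘(ℝ, E) x)
    (ξ : CotangentBundle E M) :
    TangentSpace (cotangentModel E) ξ →L[ℝ] TangentSpace (cotangentModel E) ξ :=
  sharpForm (thetaTensor R) ξ

/-! ### Tensor fields on the base and the lifts they define -/

variable [FiniteDimensional ℝ E]

/-- The tensor `(X, Y) ↦ B(Y, X)`. -/
def swapArgs {x : M}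
    (B : TangentSpace 𝓘(ℝ, E) x →L[ℝ] TangentSpace 𝓘(ℝ, E) x →L[ℝ] TangentSpace 𝓘(ℝ, E) x) :
    TangentSpace 𝓘(ℝ, E) x →L[ℝ] TangentSpace 𝓘(ℝ, E) x →L[ℝ] TangentSpace 𝓘(ℝ, E) x :=
  ContinuousLinearMap.flip (E := E) (F := E) (G := E) B

/-- The tensor `∇J`, `(∇J)(X, Y) = ∇_X (J Y) - J ∇_X Y`. -/
def nablaJ (cov : CovariantDerivative 𝓘(ℝ, E) E (TangentSpace 𝓘(ℝ, E) : M → Type _))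
    (J : AlmostComplexStructure E M) (x : M) :
    TangentSpace 𝓘(ℝ, E) x →L[ℝ] TangentSpace 𝓘(ℝ, E) x →L[ℝ] TangentSpace 𝓘(ℝ, E) x :=
  swapArgs (TensorialAt.mkHom (fun Y => nablaJAux cov J Y x) x (nablaJAux_tensorial cov J x))

/-- The symmetrised connection `∇̃ = ∇ - (1/2) T`, where `T` is the torsion of `∇`. -/
def symmetrize (cov : CovariantDerivative 𝓘(ℝ, E) E (TangentSpace 𝓘(ℝ, E) : M → Type _)) :
    CovariantDerivative 𝓘(ℝ, E) E (TangentSpace 𝓘(ℝ, E) : M → Type _) :=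
  cov.addOneForm (fun x => -((1 / 2 : ℝ) • swapArgs (cov.torsion x)))

/-- The tensor `[∇J](X, Y) = -(∇J)(X, Y) + (∇J)(Y, X)`. -/
def bracketNablaJ (cov : CovariantDerivative 𝓘(ℝ, E) E (TangentSpace 𝓘(ℝ, E) : M → Type _))
    (J : AlmostComplexStructure E M) (x : M) :
    TangentSpace 𝓘(ℝ, E) x →L[ℝ] TangentSpace 𝓘(ℝ, E) x →L[ℝ] TangentSpace 𝓘(ℝ, E) x :=
  -nablaJ cov J x + swapArgs (nablaJ cov J x)

/-- `[JX, JY] - J[X, JY] - J[JX, Y] - [X, Y]`, on vector fields. -/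
def nijenhuisAux (J : AlmostComplexStructure E M) (X Y : ∀ x : M, TangentSpace 𝓘(ℝ, E) x) (x : M) :
    TangentSpace 𝓘(ℝ, E) x :=
  mlieBracket 𝓘(ℝ, E) (J.mulField X) (J.mulField Y) x
    - J x (mlieBracket 𝓘(ℝ, E) X (J.mulField Y) x)
    - J x (mlieBracket 𝓘(ℝ, E) (J.mulField X) Y x)
    - mlieBracket 𝓘(ℝ, E) X Y x

theorem nijenhuisAux_tensorial_left (J : AlmostComplexStructure E M) (x : M)
    (Y : ∀ x : M, TangentSpace 𝓘(ℝ, E) x) :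
    TensorialAt 𝓘(ℝ, E) E (fun X => nijenhuisAux J X Y x) x where
  smul hf hX := by
    simp only [nijenhuisAux, J.mulField_smul, mlieBracket_smul_left hf hX,
      mlieBracket_smul_left hf (J.mdifferentiableAt_mulField hX), map_add, map_smul]
    simp only [AlmostComplexStructure.mulField, J.sq_eq_neg]
    module
  add hX hX' := by
    simp only [nijenhuisAux, J.mulField_add, mlieBracket_add_left hX hX',
      mlieBracket_add_left (J.mdifferentiableAt_mulField hX) (J.mdifferentiableAt_mulField hX'),
      map_add]
    module

theorem nijenhuisAux_tensorial_right (J : AlmostComplexStructure E M) (x : M)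
    (X : ∀ x : M, TangentSpace 𝓘(ℝ, E) x) :
    TensorialAt 𝓘(ℝ, E) E (fun Y => nijenhuisAux J X Y x) x where
  smul hf hY := by
    simp only [nijenhuisAux, J.mulField_smul, mlieBracket_smul_right hf hY,
      mlieBracket_smul_right hf (J.mdifferentiableAt_mulField hY), map_add, map_smul]
    simp only [AlmostComplexStructure.mulField, J.sq_eq_neg]
    module
  add hY hY' := by
    simp only [nijenhuisAux, J.mulField_add, mlieBracket_add_right hY hY',
      mlieBracket_add_right (J.mdifferentiableAt_mulField hY) (J.mdifferentiableAt_mulField hY'),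
      map_add]
    module

/-- The Nijenhuis tensor `N_J(X, Y) = [JX, JY] - J[X, JY] - J[JX, Y] - [X, Y]`. -/
def nijenhuis (J : AlmostComplexStructure E M) (x : M) :
    TangentSpace 𝓘(ℝ, E) x →L[ℝ] TangentSpace 𝓘(ℝ, E) x →L[ℝ] TangentSpace 𝓘(ℝ, E) x :=
  TensorialAt.mkHom₂ (fun X Y => nijenhuisAux J X Y x) x
    (fun Y _ => nijenhuisAux_tensorial_left J x Y)
    (fun X _ => nijenhuisAux_tensorial_right J x X)

/-- The tensor `J N_J`. -/
def mulNijenhuis (J : AlmostComplexStructure E M) (x : M) :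
    TangentSpace 𝓘(ℝ, E) x →L[ℝ] TangentSpace 𝓘(ℝ, E) x →L[ℝ] TangentSpace 𝓘(ℝ, E) x :=
  (ContinuousLinearMap.compL ℝ E E E (J x)).comp (nijenhuis J x)

/-- The complete lift `J̃ = J^c - (1/2) γ(J N_J)`. -/
def completeLift (J : AlmostComplexStructure E M) (ξ : CotangentBundle E M) :
    TangentSpace (cotangentModel E) ξ →L[ℝ] TangentSpace (cotangentModel E) ξ :=
  liftC J ξ - (1 / 2 : ℝ) • contraction (mulNijenhuis J) ξ

/-- The horizontal lift `J^{H,∇} = J^c + γ([∇̃J])`. -/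
def horizontalLift (cov : CovariantDerivative 𝓘(ℝ, E) E (TangentSpace 𝓘(ℝ, E) : M → Type _))
    (J : AlmostComplexStructure E M) (ξ : CotangentBundle E M) :
    TangentSpace (cotangentModel E) ξ →L[ℝ] TangentSpace (cotangentModel E) ξ :=
  liftC J ξ + contraction (bracketNablaJ (symmetrize cov) J) ξ

/-- The fiberwise multiplication by `a + i b` on `T^*M`: `Z (x, p) = (x, a p + b ᵗJ p)`. -/
def fiberMul (J : AlmostComplexStructure E M) (a b : ℝ) (ξ : CotangentBundle E M) :
    CotangentBundle E M :=
  ⟨ξ.proj, a • ξ.snd + b • ξ.snd.comp (J ξ.proj)⟩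

end

end AlmostComplex

/-! Everything is pointwise in the chart of `T^*M` induced by the preferred chart of `M`. At the
centre of that chart the identification of the tangent space with the model is the identity, so only
the value of `J` and its first derivative `∂J` remain. For `U = (X, α)` at `ξ = (x, p)`: `J^c U =
(JX, α∘J + p(∂_X J · - ∂_· J X))`, `γ(R) U = (0, p∘R(X, ·))`, `dZ U = (X, aα + b(p∘∂_X J + α∘J))`;
see `liftC_apply`, `contraction_apply`, `mfderiv_fiberMul_apply`.

Let `A = J^c + γ(R)`. In `A∘dZ - dZ∘A` the base components, all terms in `α` and all terms in `a`
cancel. What is left, evaluated at `V`, is `b p(J R(X,V) - R(X,JV) - N_J(X,V))`, since the surviving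
terms in `∂J` are exactly the coordinate expression of `N_J` (`nijenhuis_apply`). As `b ≠ 0` and `p`
is arbitrary, holomorphy amounts to the tensor identity `J R(X,Y) - R(X,JY) = N_J(X,Y)` on `M`
(`isHolomorphic_fiberMul_iff`).

For the complete lift, `R = -½ J N_J`, and the identity follows from `N_J(X,JY) = -J N_J(X,Y)`
(`nijenhuis_endo_right`): each of the two terms contributes `½ N_J`.

For the horizontal lift, put `S = ∇̃J`. Since `∇̃` is torsion free, `N_J(X,Y) = S(JX,Y) - S(JY,X) -
J S(X,Y) + J S(Y,X)`; also `S(X,JY) = -J S(X,Y)`. Substituting `R(X,Y) = -S(X,Y) + S(Y,X)`, the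
defect of the identity is `S(X,JY) - S(JX,Y)`. -/

namespace AlmostComplex

/-! ### Coordinate frames on `M` and `J` in a chart -/

variable {E : Type*} [NormedAddCommGroup E] [NormedSpace ℝ E]
  {M : Type*} [TopologicalSpace M] [ChartedSpace E M] [IsManifold 𝓘(ℝ, E) ∞ M]

/-- The linear isomorphism from the model space to the tangent space at `y` given by the
preferred chart at `x₀`. -/
noncomputable def frame (x₀ y : M) : E →L[ℝ] TangentSpace 𝓘(ℝ, E) y :=
  (trivializationAt E (TangentSpace 𝓘(ℝ, E) : M → Type _) x₀).symmL ℝ y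

/-- The inverse of `frame`. -/
noncomputable def coframe (x₀ y : M) : TangentSpace 𝓘(ℝ, E) y →L[ℝ] E :=
  (trivializationAt E (TangentSpace 𝓘(ℝ, E) : M → Type _) x₀).continuousLinearMapAt ℝ y

theorem frame_coframe {x₀ y : M} (hy : y ∈ (chartAt E x₀).source) (v : TangentSpace 𝓘(ℝ, E) y) :
    frame x₀ y (coframe x₀ y v) = v :=
  (trivializationAt E (TangentSpace 𝓘(ℝ, E) : M → Type _) x₀).symmL_continuousLinearMapAt
    (by simpa using hy) v

theorem coframe_frame {x₀ y : M} (hy : y ∈ (chartAt E x₀).source) (v : E) :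
    coframe x₀ y (frame x₀ y v) = v :=
  (trivializationAt E (TangentSpace 𝓘(ℝ, E) : M → Type _) x₀).continuousLinearMapAt_symmL
    (by simpa using hy) v

/-- The tangent space at `x` is modelled on `E` through this very chart, so no transition map
appears at the centre. This is what makes formulas at a single point free of frames. -/
theorem coframe_self (x : M) (v : E) : coframe x x v = v := by
  unfold coframe
  rw [TangentBundle.continuousLinearMapAt_trivializationAt (mem_chart_source E x),
    mfderiv_extChartAt_self]
  rfl

theorem frame_self (x : M) (v : E) : frame x x v = v := by
  have h := frame_coframe (mem_chart_source E x) (v : TangentSpace 𝓘(ℝ, E) x)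
  rwa [coframe_self] at h

/-- The covector `ξ` as a linear form on the model space. -/
noncomputable def covector (ξ : CotangentBundle E M) : E →L[ℝ] ℝ := ξ.snd

/-- The endomorphism `J x` as an endomorphism of the model space. -/
noncomputable def AlmostComplexStructure.endo (J : AlmostComplexStructure E M) (x : M) :
    E →L[ℝ] E := J x

theorem AlmostComplexStructure.endo_endo (J : AlmostComplexStructure E M) (x : M) (v : E) :
    J.endo x (J.endo x v) = -v :=
  J.sq_eq_neg x v

/-- The coordinate expression of `J` in the preferred chart at `x₀`. -/
noncomputable def AlmostComplexStructure.inChart (J : AlmostComplexStructure E M) (x₀ : M) (z : E) :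
    E →L[ℝ] E :=
  (coframe x₀ ((extChartAt 𝓘(ℝ, E) x₀).symm z)).comp
    ((J ((extChartAt 𝓘(ℝ, E) x₀).symm z)).comp (frame x₀ ((extChartAt 𝓘(ℝ, E) x₀).symm z)))

theorem AlmostComplexStructure.contMDiffAt_inCoordinates (J : AlmostComplexStructure E M) (x₀ : M) :
    ContMDiffAt 𝓘(ℝ, E) 𝓘(ℝ, E →L[ℝ] E) ∞
      (fun y => ((coframe x₀ y).comp ((J y).comp (frame x₀ y)) : E →L[ℝ] E)) x₀ :=
  ((contMDiffAt_hom_bundle _).1 (J.contMDiff_toFun x₀)).2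

theorem AlmostComplexStructure.contDiffAt_inChart (J : AlmostComplexStructure E M) (x₀ : M) :
    ContDiffAt ℝ ∞ (J.inChart x₀) (extChartAt 𝓘(ℝ, E) x₀ x₀) := by
  rw [← contMDiffAt_iff_contDiffAt]
  have h1 := (contMDiffOn_extChartAt_symm (I := 𝓘(ℝ, E)) (n := ∞) x₀).contMDiffAt
    (extChartAt_target_mem_nhds x₀)
  exact ContMDiffAt.comp (extChartAt 𝓘(ℝ, E) x₀ x₀)
    (g := fun y => ((coframe x₀ y).comp ((J y).comp (frame x₀ y)) : E →L[ℝ] E))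
    (by rw [extChartAt_to_inv]; exact J.contMDiffAt_inCoordinates x₀) h1

theorem AlmostComplexStructure.inChart_self (J : AlmostComplexStructure E M) (x : M) :
    J.inChart x (extChartAt 𝓘(ℝ, E) x x) = J.endo x := by
  unfold AlmostComplexStructure.inChart
  rw [extChartAt_to_inv]
  refine ContinuousLinearMap.ext fun v => ?_
  exact (coframe_self x _).trans (congrArg (J x) (frame_self x v))

theorem AlmostComplexStructure.frame_inChart (J : AlmostComplexStructure E M) (x₀ : M) {z : E}
    (hz : z ∈ (extChartAt 𝓘(ℝ, E) x₀).target) (v : E) :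
    frame x₀ ((extChartAt 𝓘(ℝ, E) x₀).symm z) (J.inChart x₀ z v) =
      J ((extChartAt 𝓘(ℝ, E) x₀).symm z) (frame x₀ ((extChartAt 𝓘(ℝ, E) x₀).symm z) v) :=
  frame_coframe (by simpa using (extChartAt 𝓘(ℝ, E) x₀).map_target hz) _

/-! ### Charts of the cotangent bundle -/

theorem fst_mem_of_mem_extChartAt_target {ξ : CotangentBundle E M} {z : E × (E →L[ℝ] ℝ)}
    (hz : z ∈ (extChartAt (cotangentModel E) ξ).target) :
    z.1 ∈ (extChartAt 𝓘(ℝ, E) ξ.proj).target := by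
  rw [FiberBundle.extChartAt_target] at hz
  exact hz.1.1

theorem proj_extChartAt_symm {ξ : CotangentBundle E M} {z : E × (E →L[ℝ] ℝ)}
    (hz : z ∈ (extChartAt (cotangentModel E) ξ).target) :
    ((extChartAt (cotangentModel E) ξ).symm z).proj = (extChartAt 𝓘(ℝ, E) ξ.proj).symm z.1 := by
  rw [FiberBundle.extChartAt_target] at hz
  rw [FiberBundle.extChartAt]
  exact Trivialization.proj_symm_apply' (trivializationAt (E →L[ℝ] ℝ)
    (fun x : M => TangentSpace 𝓘(ℝ, E) x →L[ℝ] ℝ) ξ.proj) hz.1.2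

theorem fst_extChartAt (ξ η : CotangentBundle E M) :
    (extChartAt (cotangentModel E) ξ η).1 = extChartAt 𝓘(ℝ, E) ξ.proj η.proj := by
  rw [FiberBundle.extChartAt]
  rfl

/-- The cotangent trivialization is dual to the tangent one: a covector is read by precomposing it
with the frame, the line-bundle factor being trivial. -/
theorem snd_trivializationAt (x₀ : M) (η : CotangentBundle E M) :
    (trivializationAt (E →L[ℝ] ℝ) (fun x : M => TangentSpace 𝓘(ℝ, E) x →L[ℝ] ℝ) x₀ η).2 =
      η.snd.comp (frame x₀ η.proj) := by
  refine ContinuousLinearMap.ext fun v => ?_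
  change ContinuousLinearMap.inCoordinates E (TangentSpace 𝓘(ℝ, E) : M → Type _) ℝ
    (fun _ : M => ℝ) x₀ η.proj x₀ η.proj η.snd v = _
  unfold ContinuousLinearMap.inCoordinates
  rw [ContinuousLinearMap.comp_apply, ContinuousLinearMap.comp_apply]
  exact congrArg (fun L : ℝ →ₗ[ℝ] ℝ => L _)
    (Bundle.Trivial.linearMapAt_trivialization ℝ M ℝ η.proj)

theorem snd_extChartAt (ξ η : CotangentBundle E M) :
    (extChartAt (cotangentModel E) ξ η).2 = η.snd.comp (frame ξ.proj η.proj) := by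
  rw [FiberBundle.extChartAt]
  exact snd_trivializationAt ξ.proj η

theorem extChartAt_cotangent_self (ξ : CotangentBundle E M) :
    extChartAt (cotangentModel E) ξ ξ = (extChartAt 𝓘(ℝ, E) ξ.proj ξ.proj, covector ξ) := by
  refine Prod.ext (fst_extChartAt ξ ξ) ?_
  refine (snd_extChartAt ξ ξ).trans ?_
  exact ContinuousLinearMap.ext fun v => congrArg ξ.snd (frame_self ξ.proj v)

theorem mfderiv_extChartAt_symm_eq_frame (x₀ : M) {z : E}
    (hz : z ∈ (extChartAt 𝓘(ℝ, E) x₀).target) (v : E) :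
    mfderiv 𝓘(ℝ, E) 𝓘(ℝ, E) (extChartAt 𝓘(ℝ, E) x₀).symm z v =
      frame x₀ ((extChartAt 𝓘(ℝ, E) x₀).symm z) v := by
  unfold frame
  rw [TangentBundle.symmL_trivializationAt
      (by simpa using (extChartAt 𝓘(ℝ, E) x₀).map_target hz),
    (extChartAt 𝓘(ℝ, E) x₀).right_inv hz, ModelWithCorners.range_eq_univ, mfderivWithin_univ]
  rfl

/-- In charts `π` is the first projection, `π ∘ φ⁻¹ = ψ⁻¹ ∘ fst`. Differentiating both sides and
using uniqueness of the derivative gives the formula. -/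
theorem dproj_mfderiv_extChartAt_symm (ξ : CotangentBundle E M) {z : E × (E →L[ℝ] ℝ)}
    (hz : z ∈ (extChartAt (cotangentModel E) ξ).target) (U : E × (E →L[ℝ] ℝ)) :
    dproj ((extChartAt (cotangentModel E) ξ).symm z)
        (mfderiv 𝓘(ℝ, E × (E →L[ℝ] ℝ)) (cotangentModel E)
          (extChartAt (cotangentModel E) ξ).symm z U) =
      frame ξ.proj ((extChartAt (cotangentModel E) ξ).symm z).proj U.1 := by
  have hsym : MDifferentiableAt 𝓘(ℝ, E × (E →L[ℝ] ℝ)) (cotangentModel E)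
      (extChartAt (cotangentModel E) ξ).symm z := by
    have := mdifferentiableWithinAt_extChartAt_symm (I := cotangentModel E) hz
    rwa [ModelWithCorners.range_eq_univ, mdifferentiableWithinAt_univ] at this
  have hpm : ContMDiff (cotangentModel E) 𝓘(ℝ, E) 1
      (fun η : CotangentBundle E M => η.proj) :=
    Bundle.contMDiff_proj (fun x : M => TangentSpace 𝓘(ℝ, E) x →L[ℝ] ℝ)
  have hp := hpm.mdifferentiable one_ne_zero ((extChartAt (cotangentModel E) ξ).symm z)
  have hzψ := fst_mem_of_mem_extChartAt_target hz
  have hsymψ : MDifferentiableAt 𝓘(ℝ, E) 𝓘(ℝ, E) (extChartAt 𝓘(ℝ, E) ξ.proj).symm z.1 := by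
    have := mdifferentiableWithinAt_extChartAt_symm (I := 𝓘(ℝ, E)) hzψ
    rwa [ModelWithCorners.range_eq_univ, mdifferentiableWithinAt_univ] at this
  have hcomp : (fun w => ((extChartAt (cotangentModel E) ξ).symm w).proj) =ᶠ[𝓝 z]
      (fun w => (extChartAt 𝓘(ℝ, E) ξ.proj).symm w.1) := by
    filter_upwards [(isOpen_extChartAt_target ξ).mem_nhds hz] with w hw
    exact proj_extChartAt_symm hw
  have hd : HasMFDerivAt 𝓘(ℝ, E × (E →L[ℝ] ℝ)) 𝓘(ℝ, E)
      (fun w => ((extChartAt (cotangentModel E) ξ).symm w).proj) z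
      ((dproj ((extChartAt (cotangentModel E) ξ).symm z)).comp
        (mfderiv 𝓘(ℝ, E × (E →L[ℝ] ℝ)) (cotangentModel E)
          (extChartAt (cotangentModel E) ξ).symm z)) :=
    HasMFDerivAt.comp (g := fun η : CotangentBundle E M => η.proj) z hp.hasMFDerivAt
      hsym.hasMFDerivAt
  have hd2 : HasMFDerivAt 𝓘(ℝ, E × (E →L[ℝ] ℝ)) 𝓘(ℝ, E)
      (fun w : E × (E →L[ℝ] ℝ) => (extChartAt 𝓘(ℝ, E) ξ.proj).symm w.1) z
      ((mfderiv 𝓘(ℝ, E) 𝓘(ℝ, E) (extChartAt 𝓘(ℝ, E) ξ.proj).symm z.1).comp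
        (ContinuousLinearMap.fst ℝ E (E →L[ℝ] ℝ))) := by
    refine HasMFDerivAt.comp (g := (extChartAt 𝓘(ℝ, E) ξ.proj).symm)
      (f := fun w : E × (E →L[ℝ] ℝ) => w.1) z hsymψ.hasMFDerivAt ?_
    exact (ContinuousLinearMap.fst ℝ E (E →L[ℝ] ℝ)).hasFDerivAt.hasMFDerivAt
  have hd3 := hasMFDerivAt_unique hd (hd2.congr_of_eventuallyEq hcomp)
  have h4 := congrArg (fun L : E × (E →L[ℝ] ℝ) →L[ℝ] E => L U) hd3
  refine h4.trans ?_
  rw [proj_extChartAt_symm hz]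
  exact mfderiv_extChartAt_symm_eq_frame ξ.proj hzψ U.1

/-! ### `J^c` and `γ(R)` in coordinates -/

/-- The form `θ(J)` in coordinates, `p_k J^k_i dx^i`. -/
theorem oneFormInChart_thetaJ (J : AlmostComplexStructure E M) (ξ : CotangentBundle E M)
    {z : E × (E →L[ℝ] ℝ)} (hz : z ∈ (extChartAt (cotangentModel E) ξ).target)
    (U : E × (E →L[ℝ] ℝ)) :
    oneFormInChart (cotangentModel E) (thetaJ J) ξ z U = z.2 (J.inChart ξ.proj z.1 U.1) := by
  have h1 := dproj_mfderiv_extChartAt_symm ξ hz U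
  -- `θ(J)(U) = θ(U')` for any `U'` whose base component is `J` applied to that of `U`; zero is a
  -- convenient fibre component, and the known formula for `θ` applies to `U'`.
  have h2 := dproj_mfderiv_extChartAt_symm ξ hz (J.inChart ξ.proj z.1 U.1, 0)
  have h3 := oneFormInChart_liouville ξ hz (J.inChart ξ.proj z.1 U.1, 0)
  refine Eq.trans ?_ h3
  refine congrArg ((extChartAt (cotangentModel E) ξ).symm z).snd ?_
  refine (congrArg (J _) h1).trans (Eq.trans ?_ h2.symm)
  rw [proj_extChartAt_symm hz]
  exact (J.frame_inChart ξ.proj (fst_mem_of_mem_extChartAt_target hz) U.1).symm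

/-- The derivative at `x` of the coordinate expression of `J` in the preferred chart at `x`:
`J.deriv x X Y = (∂_X J) Y`. -/
noncomputable def AlmostComplexStructure.deriv (J : AlmostComplexStructure E M) (x : M) :
    E →L[ℝ] E →L[ℝ] E :=
  fderiv ℝ (J.inChart x) (extChartAt 𝓘(ℝ, E) x x)

theorem AlmostComplexStructure.hasFDerivAt_inChart (J : AlmostComplexStructure E M) (x : M) :
    HasFDerivAt (J.inChart x) (J.deriv x) (extChartAt 𝓘(ℝ, E) x x) :=
  ((J.contDiffAt_inChart x).differentiableAt (by simp)).hasFDerivAt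

/-- Product rule for `(x, p) ↦ p ∘ J(x)`. This map is both the coefficient of `θ(J)` and the
`b`-part of `Z`, so it feeds `J^c` and `dZ` alike. -/
theorem AlmostComplexStructure.hasFDerivAt_comp_inChart (J : AlmostComplexStructure E M) (x : M)
    (p : E →L[ℝ] ℝ) :
    HasFDerivAt (fun z : E × (E →L[ℝ] ℝ) => z.2.comp (J.inChart x z.1))
      ((ContinuousLinearMap.compL ℝ E E ℝ p).comp
          ((J.deriv x).comp (ContinuousLinearMap.fst ℝ E (E →L[ℝ] ℝ))) +
        ((ContinuousLinearMap.compL ℝ E E ℝ).flip (J.endo x)).comp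
          (ContinuousLinearMap.snd ℝ E (E →L[ℝ] ℝ)))
      (extChartAt 𝓘(ℝ, E) x x, p) := by
  have h1 : HasFDerivAt (fun z : E × (E →L[ℝ] ℝ) => J.inChart x z.1)
      ((J.deriv x).comp (ContinuousLinearMap.fst ℝ E (E →L[ℝ] ℝ)))
      (extChartAt 𝓘(ℝ, E) x x, p) :=
    HasFDerivAt.comp (g := J.inChart x) (extChartAt 𝓘(ℝ, E) x x, p) (J.hasFDerivAt_inChart x)
      hasFDerivAt_fst
  have h2 : HasFDerivAt (fun z : E × (E →L[ℝ] ℝ) => z.2)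
      (ContinuousLinearMap.snd ℝ E (E →L[ℝ] ℝ)) (extChartAt 𝓘(ℝ, E) x x, p) := hasFDerivAt_snd
  have h := h2.clm_comp h1
  rwa [show J.inChart x (extChartAt 𝓘(ℝ, E) x x, p).1 = J.endo x from
    J.inChart_self x] at h

theorem hasFDerivAt_comp_right {F G G' : Type*} [NormedAddCommGroup F] [NormedSpace ℝ F]
    [NormedAddCommGroup G] [NormedSpace ℝ G] [NormedAddCommGroup G'] [NormedSpace ℝ G']
    {g : F → G →L[ℝ] ℝ} {g' : F →L[ℝ] G →L[ℝ] ℝ} {z : F} (h : HasFDerivAt g g' z)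
    (L : G' →L[ℝ] G) :
    HasFDerivAt (fun w => (g w).comp L) ((ContinuousLinearMap.precomp ℝ L).comp g') z :=
  (ContinuousLinearMap.precomp ℝ L : (G →L[ℝ] ℝ) →L[ℝ] G' →L[ℝ] ℝ).hasFDerivAt.comp z h

theorem extDerivOneForm_thetaJ_apply (J : AlmostComplexStructure E M) (ξ : CotangentBundle E M)
    (U V : E × (E →L[ℝ] ℝ)) :
    extDerivOneForm (cotangentModel E) (thetaJ J) ξ U V =
      (covector ξ (J.deriv ξ.proj U.1 V.1) + U.2 (J.endo ξ.proj V.1)) -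
        (covector ξ (J.deriv ξ.proj V.1 U.1) + V.2 (J.endo ξ.proj U.1)) := by
  have hG := J.hasFDerivAt_comp_inChart ξ.proj (covector ξ)
  have hpre := hasFDerivAt_comp_right hG (ContinuousLinearMap.fst ℝ E (E →L[ℝ] ℝ))
  have hev : oneFormInChart (cotangentModel E) (thetaJ J) ξ
      =ᶠ[𝓝 (extChartAt (cotangentModel E) ξ ξ)]
      (fun z : E × (E →L[ℝ] ℝ) => (z.2.comp (J.inChart ξ.proj z.1)).comp
        (ContinuousLinearMap.fst ℝ E (E →L[ℝ] ℝ))) := by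
    filter_upwards [(isOpen_extChartAt_target ξ).mem_nhds
      (mem_extChartAt_target (I := cotangentModel E) ξ)] with z hz
    exact ContinuousLinearMap.ext fun U => oneFormInChart_thetaJ J ξ hz U
  have h := extDerivOneForm_eq (cotangentModel E)
    (HasFDerivAt.congr_of_eventuallyEq (by rw [extChartAt_cotangent_self]; exact hpre) hev) U V
  exact h

/-- Pairing with `(0, f)` determines the base component, pairing with `(v, 0)` the covector
component. An endomorphism defined through `ω` is thus computed by guessing its value and testing
it. -/
theorem canonicalForm_left_injective (ξ : CotangentBundle E M) (A B : E × (E →L[ℝ] ℝ))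
    (h : ∀ V : E × (E →L[ℝ] ℝ), canonicalForm E M ξ A V = canonicalForm E M ξ B V) : A = B := by
  have h' : ∀ V : E × (E →L[ℝ] ℝ), A.2 V.1 - V.2 A.1 = B.2 V.1 - V.2 B.1 := fun V => by
    rw [← canonicalForm_apply ξ A V, ← canonicalForm_apply ξ B V]
    exact h V
  refine Prod.ext ?_ ?_
  · refine sub_eq_zero.1 (by_contra fun hne => ?_)
    obtain ⟨f, hf⟩ := SeparatingDual.exists_ne_zero (R := ℝ) hne
    have := h' (0, f)
    simp only [map_zero, zero_sub, neg_inj] at this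
    exact hf (by rw [map_sub, this, sub_self])
  · ext v
    simpa using h' (v, 0)

theorem liftC_apply [FiniteDimensional ℝ E] (J : AlmostComplexStructure E M)
    (ξ : CotangentBundle E M) (U : E × (E →L[ℝ] ℝ)) :
    liftC J ξ U = (J.endo ξ.proj U.1,
      U.2.comp (J.endo ξ.proj) + (covector ξ).comp
        (J.deriv ξ.proj U.1 - (J.deriv ξ.proj).flip U.1)) := by
  refine canonicalForm_left_injective ξ _ _ fun V => ?_
  refine (canonicalForm_sharpForm _ ξ U V).trans ?_
  refine (extDerivOneForm_thetaJ_apply J ξ U V).trans ?_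
  refine Eq.trans ?_ (canonicalForm_apply ξ _ _).symm
  simp only [add_apply, sub_apply, ContinuousLinearMap.comp_apply,
    ContinuousLinearMap.flip_apply, map_sub]
  ring

/-- The chart formula for `dπ` at the centre, where both the inverse chart's derivative and the
frame are the identity. -/
theorem dproj_apply (ξ : CotangentBundle E M) (U : E × (E →L[ℝ] ℝ)) : dproj ξ U = U.1 := by
  have hp : MDifferentiableAt (cotangentModel E) 𝓘(ℝ, E)
      (fun η : CotangentBundle E M => η.proj) ξ :=
    (Bundle.contMDiff_proj (n := 1)
      (fun x : M => TangentSpace 𝓘(ℝ, E) x →L[ℝ] ℝ)).mdifferentiable one_ne_zero ξ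
  have h := dproj_mfderiv_extChartAt_symm ξ (mem_extChartAt_target (I := cotangentModel E) ξ) U
  have h2 := mfderivWithin_range_extChartAt_symm (I := cotangentModel E) (x := ξ)
  rw [ModelWithCorners.range_eq_univ, mfderivWithin_univ] at h2
  rw [extChartAt_to_inv] at h
  refine Eq.trans ?_ (h.trans (frame_self ξ.proj U.1))
  exact congrArg (dproj ξ)
    (congrArg (fun L : E × (E →L[ℝ] ℝ) →L[ℝ] E × (E →L[ℝ] ℝ) => L U) h2).symm

/-- A bilinear map on a tangent space as a bilinear map on the model space. -/
def modelTensor {x : M}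
    (B : TangentSpace 𝓘(ℝ, E) x →L[ℝ] TangentSpace 𝓘(ℝ, E) x →L[ℝ] TangentSpace 𝓘(ℝ, E) x) :
    E →L[ℝ] E →L[ℝ] E := B

theorem contraction_apply [FiniteDimensional ℝ E]
    (R : ∀ x : M, TangentSpace 𝓘(ℝ, E) x →L[ℝ] TangentSpace 𝓘(ℝ, E) x →L[ℝ] TangentSpace 𝓘(ℝ, E) x)
    (ξ : CotangentBundle E M) (U : E × (E →L[ℝ] ℝ)) :
    contraction R ξ U = ((0 : E), (covector ξ).comp (modelTensor (R ξ.proj) U.1)) := by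
  refine canonicalForm_left_injective ξ _ _ fun V => ?_
  refine (canonicalForm_sharpForm _ ξ U V).trans ?_
  refine Eq.trans ?_ (canonicalForm_apply ξ _ _).symm
  have e : thetaTensor R ξ U V = ξ.snd (R ξ.proj (dproj ξ U) (dproj ξ V)) := rfl
  rw [e, dproj_apply, dproj_apply, map_zero, sub_zero]
  rfl

/-! ### The map `Z`: smoothness and differential -/

theorem fiberMul_snd_comp_frame (J : AlmostComplexStructure E M) (a b : ℝ) {x₀ : M}
    {η : CotangentBundle E M} (hη : η.proj ∈ (chartAt E x₀).source) :
    ((fiberMul J a b η).snd.comp (frame x₀ η.proj) : E →L[ℝ] ℝ) =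
      a • η.snd.comp (frame x₀ η.proj) + b • (η.snd.comp (frame x₀ η.proj)).comp
        ((coframe x₀ η.proj).comp ((J η.proj).comp (frame x₀ η.proj))) := by
  refine ContinuousLinearMap.ext fun v => ?_
  have h := congrArg (fun w => b * η.snd w)
    (frame_coframe hη (J η.proj (frame x₀ η.proj v)))
  exact congrArg (fun t : ℝ => a * η.snd (frame x₀ η.proj v) + t) h.symm

theorem contMDiff_fiberMul (J : AlmostComplexStructure E M) (a b : ℝ) :
    ContMDiff (cotangentModel E) (cotangentModel E) ∞ (fiberMul J a b) := by
  intro ξ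
  have hproj : ContMDiff (cotangentModel E) 𝓘(ℝ, E) ∞ (fun η : CotangentBundle E M => η.proj) :=
    Bundle.contMDiff_proj (fun x : M => TangentSpace 𝓘(ℝ, E) x →L[ℝ] ℝ)
  refine contMDiffAt_totalSpace.2 ⟨hproj ξ, ?_⟩
  have hc : ContMDiffAt (cotangentModel E) 𝓘(ℝ, E →L[ℝ] ℝ) ∞ (fun η : CotangentBundle E M =>
      (trivializationAt (E →L[ℝ] ℝ) (fun x : M => TangentSpace 𝓘(ℝ, E) x →L[ℝ] ℝ) ξ.proj η).2) ξ :=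
    (contMDiffAt_totalSpace.1
    (contMDiffAt_id (I := cotangentModel E) (n := ∞) (x := ξ))).2
  have hJ := ContMDiffAt.comp ξ (J.contMDiffAt_inCoordinates ξ.proj) (hproj ξ)
  have hmem : ∀ᶠ η : CotangentBundle E M in 𝓝 ξ, η.proj ∈ (chartAt E ξ.proj).source :=
    (hproj ξ).continuousAt.eventually_mem (chart_source_mem_nhds E ξ.proj)
  have hadd := ((contMDiffAt_const (I := cotangentModel E) (I' := 𝓘(ℝ, ℝ)) (c := a)).smul hc).add
    ((contMDiffAt_const (I := cotangentModel E) (I' := 𝓘(ℝ, ℝ)) (c := b)).smul (hc.clm_comp hJ))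
  refine hadd.congr_of_eventuallyEq ?_
  filter_upwards [hmem] with η hη
  refine (snd_trivializationAt ξ.proj (fiberMul J a b η)).trans
    ((fiberMul_snd_comp_frame J a b hη).trans ?_)
  exact congrArg (fun c : E →L[ℝ] ℝ => a • c + b • c.comp
    ((coframe ξ.proj η.proj).comp ((J η.proj).comp (frame ξ.proj η.proj))))
    (snd_trivializationAt ξ.proj η).symm

/-- `Z` preserves base points and the chart of `T^*M` at a point depends only on its base point, so
source and target are read in the same chart. -/
theorem extChartAt_fiberMul (J : AlmostComplexStructure E M) (a b : ℝ) (ξ : CotangentBundle E M)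
    {z : E × (E →L[ℝ] ℝ)} (hz : z ∈ (extChartAt (cotangentModel E) ξ).target) :
    extChartAt (cotangentModel E) (fiberMul J a b ξ)
        (fiberMul J a b ((extChartAt (cotangentModel E) ξ).symm z)) =
      (z.1, a • z.2 + b • z.2.comp (J.inChart ξ.proj z.1)) := by
  have hr := (extChartAt (cotangentModel E) ξ).right_inv hz
  have hp := proj_extChartAt_symm hz
  have hs : ((extChartAt (cotangentModel E) ξ).symm z).proj ∈ (chartAt E ξ.proj).source := by
    rw [hp]
    simpa using (extChartAt 𝓘(ℝ, E) ξ.proj).map_target (fst_mem_of_mem_extChartAt_target hz)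
  refine Prod.ext ?_ ?_
  · refine (fst_extChartAt _ _).trans ?_
    refine (fst_extChartAt ξ ((extChartAt (cotangentModel E) ξ).symm z)).symm.trans ?_
    rw [hr]
  · refine (snd_extChartAt _ _).trans ?_
    refine (fiberMul_snd_comp_frame J a b hs).trans ?_
    rw [← snd_extChartAt ξ ((extChartAt (cotangentModel E) ξ).symm z), hr, hp]
    rfl

theorem mfderiv_fiberMul_apply (J : AlmostComplexStructure E M) (a b : ℝ) (ξ : CotangentBundle E M)
    (U : E × (E →L[ℝ] ℝ)) :
    mfderiv (cotangentModel E) (cotangentModel E) (fiberMul J a b) ξ U =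
      (U.1, a • U.2 + b • ((covector ξ).comp (J.deriv ξ.proj U.1) + U.2.comp (J.endo ξ.proj))) := by
  have hd : MDifferentiableAt (cotangentModel E) (cotangentModel E) (fiberMul J a b) ξ :=
    (contMDiff_fiberMul J a b).mdifferentiable (by simp) ξ
  have hev : writtenInExtChartAt (cotangentModel E) (cotangentModel E) ξ (fiberMul J a b)
      =ᶠ[𝓝 (extChartAt (cotangentModel E) ξ ξ)]
      fun z => (z.1, a • z.2 + b • z.2.comp (J.inChart ξ.proj z.1)) := by
    filter_upwards [(isOpen_extChartAt_target ξ).mem_nhds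
      (mem_extChartAt_target (I := cotangentModel E) ξ)] with z hz
    exact extChartAt_fiberMul J a b ξ hz
  have hD := (hasFDerivAt_fst (𝕜 := ℝ) (p := (extChartAt 𝓘(ℝ, E) ξ.proj ξ.proj, covector ξ))).prodMk
    ((hasFDerivAt_snd.const_smul a).add
      ((J.hasFDerivAt_comp_inChart ξ.proj (covector ξ)).const_smul b))
  rw [← extChartAt_cotangent_self] at hD
  have h := (hD.congr_of_eventuallyEq hev).fderiv
  rw [hd.mfderiv, ModelWithCorners.range_eq_univ, fderivWithin_univ, h]
  rfl

/-! ### Lie brackets and the Nijenhuis tensor in a chart -/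

theorem mpullbackWithin_extChartAt_symm {x₀ : M} {z : E} (hz : z ∈ (extChartAt 𝓘(ℝ, E) x₀).target)
    (V : ∀ y : M, TangentSpace 𝓘(ℝ, E) y) :
    mpullbackWithin 𝓘(ℝ, E) 𝓘(ℝ, E) (extChartAt 𝓘(ℝ, E) x₀).symm V (range 𝓘(ℝ, E)) z =
      coframe x₀ ((extChartAt 𝓘(ℝ, E) x₀).symm z) (V ((extChartAt 𝓘(ℝ, E) x₀).symm z)) := by
  have hs : (extChartAt 𝓘(ℝ, E) x₀).symm z ∈ (chartAt E x₀).source := by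
    simpa using (extChartAt 𝓘(ℝ, E) x₀).map_target hz
  rw [mpullbackWithin_apply, ModelWithCorners.range_eq_univ, mfderivWithin_univ]
  have h : (mfderiv 𝓘(ℝ, E) 𝓘(ℝ, E) (extChartAt 𝓘(ℝ, E) x₀).symm z : E →L[ℝ] _) =
      frame (E := E) x₀ ((extChartAt 𝓘(ℝ, E) x₀).symm z) :=
    ContinuousLinearMap.ext fun v => mfderiv_extChartAt_symm_eq_frame (E := E) x₀ hz v
  rw [h]
  refine congrArg (fun L : TangentSpace 𝓘(ℝ, E) ((extChartAt 𝓘(ℝ, E) x₀).symm z) →L[ℝ] E => L _)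
    (ContinuousLinearMap.inverse_eq ?_ ?_)
  · exact ContinuousLinearMap.ext fun v => frame_coframe hs v
  · exact ContinuousLinearMap.ext fun v => coframe_frame hs v

/-- The Lie bracket in the preferred chart at the point. -/
theorem mlieBracket_eq_of_hasFDerivAt {x : M} {V W : ∀ y : M, TangentSpace 𝓘(ℝ, E) y}
    {v w : E → E} {v' w' : E →L[ℝ] E}
    (hV : ∀ z ∈ (extChartAt 𝓘(ℝ, E) x).target,
      coframe x ((extChartAt 𝓘(ℝ, E) x).symm z) (V ((extChartAt 𝓘(ℝ, E) x).symm z)) = v z)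
    (hW : ∀ z ∈ (extChartAt 𝓘(ℝ, E) x).target,
      coframe x ((extChartAt 𝓘(ℝ, E) x).symm z) (W ((extChartAt 𝓘(ℝ, E) x).symm z)) = w z)
    (hv : HasFDerivAt v v' (extChartAt 𝓘(ℝ, E) x x))
    (hw : HasFDerivAt w w' (extChartAt 𝓘(ℝ, E) x x)) :
    mlieBracket 𝓘(ℝ, E) V W x =
      w' (v (extChartAt 𝓘(ℝ, E) x x)) - v' (w (extChartAt 𝓘(ℝ, E) x x)) := by
  have hnhds := extChartAt_target_mem_nhds (I := 𝓘(ℝ, E)) x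
  have hV' : mpullbackWithin 𝓘(ℝ, E) 𝓘(ℝ, E) (extChartAt 𝓘(ℝ, E) x).symm V (range 𝓘(ℝ, E))
      =ᶠ[𝓝 (extChartAt 𝓘(ℝ, E) x x)] v := by
    filter_upwards [hnhds] with z hz using (mpullbackWithin_extChartAt_symm hz V).trans (hV z hz)
  have hW' : mpullbackWithin 𝓘(ℝ, E) 𝓘(ℝ, E) (extChartAt 𝓘(ℝ, E) x).symm W (range 𝓘(ℝ, E))
      =ᶠ[𝓝 (extChartAt 𝓘(ℝ, E) x x)] w := by
    filter_upwards [hnhds] with z hz using (mpullbackWithin_extChartAt_symm hz W).trans (hW z hz)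
  rw [← mlieBracketWithin_univ, mlieBracketWithin_apply, mfderiv_extChartAt_self]
  have hset : (extChartAt 𝓘(ℝ, E) x).symm ⁻¹' univ ∩ range 𝓘(ℝ, E) = univ := by simp
  rw [hset]
  -- The pulled-back fields take values in tangent spaces; abstracting them to maps `E → E` lets the
  -- vector-space bracket lemmas apply.
  suffices h : ∀ f g : E → E, f =ᶠ[𝓝 (extChartAt 𝓘(ℝ, E) x x)] v →
      g =ᶠ[𝓝 (extChartAt 𝓘(ℝ, E) x x)] w →
      (ContinuousLinearMap.id ℝ E).inverse
          (lieBracketWithin ℝ f g univ (extChartAt 𝓘(ℝ, E) x x)) =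
        w' (v (extChartAt 𝓘(ℝ, E) x x)) - v' (w (extChartAt 𝓘(ℝ, E) x x)) from
    h _ _ hV' hW'
  intro f g hf hg
  rw [lieBracketWithin_univ, ContinuousLinearMap.inverse_id, ContinuousLinearMap.id_apply,
    Filter.EventuallyEq.lieBracket_vectorField_eq hf hg, lieBracket, hv.fderiv, hw.fderiv]

/-- The field is constant in the trivialization at `x`. Such fields extend any given tangent vector,
so that tensors defined on fields can be evaluated. -/
theorem mdifferentiableAt_frame (x : M) (v : E) :
    MDiffAt (T% (fun y => frame x y v)) x := by
  have h : ContMDiffAt 𝓘(ℝ, E) (𝓘(ℝ, E).prod 𝓘(ℝ, E)) 1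
      (fun y => TotalSpace.mk' E (E := (TangentSpace 𝓘(ℝ, E) : M → Type _)) y (frame x y v)) x := by
    rw [contMDiffAt_section]
    refine (contMDiffAt_const (c := v)).congr_of_eventuallyEq ?_
    filter_upwards [chart_source_mem_nhds E x] with y hy
    have h := coframe_frame hy v
    unfold coframe at h
    rwa [Trivialization.continuousLinearMapAt_apply, Trivialization.linearMapAt_apply,
      if_pos (by simpa using hy)] at h
  exact h.mdifferentiableAt one_ne_zero

/-- The Nijenhuis tensor in coordinates. -/
theorem nijenhuis_apply [FiniteDimensional ℝ E] (J : AlmostComplexStructure E M) (x : M)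
    (X Y : E) :
    nijenhuis J x X Y = J.deriv x (J.endo x X) Y - J.deriv x (J.endo x Y) X
      - J.endo x (J.deriv x X Y) + J.endo x (J.deriv x Y X) := by
  -- By tensoriality `X` and `Y` may be extended with constant coefficients: then `[X, Y] = 0`, and
  -- the other brackets involve only first derivatives of `J`.
  have hX := mdifferentiableAt_frame x X
  have hY := mdifferentiableAt_frame x Y
  have h := TensorialAt.mkHom₂_apply (Φ := fun X Y => nijenhuisAux J X Y x)
    (fun Y _ => nijenhuisAux_tensorial_left J x Y)
    (fun X _ => nijenhuisAux_tensorial_right J x X) hX hY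
  have hs : ∀ z ∈ (extChartAt 𝓘(ℝ, E) x).target,
      (extChartAt 𝓘(ℝ, E) x).symm z ∈ (chartAt E x).source := fun z hz => by
    simpa using (extChartAt 𝓘(ℝ, E) x).map_target hz
  have c : ∀ v : E, ∀ z ∈ (extChartAt 𝓘(ℝ, E) x).target,
      coframe x ((extChartAt 𝓘(ℝ, E) x).symm z)
        (frame x ((extChartAt 𝓘(ℝ, E) x).symm z) v) = v :=
    fun v z hz => coframe_frame (hs z hz) v
  have d : ∀ v : E, ∀ z ∈ (extChartAt 𝓘(ℝ, E) x).target,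
      coframe x ((extChartAt 𝓘(ℝ, E) x).symm z)
        (J.mulField (fun y => frame x y v) ((extChartAt 𝓘(ℝ, E) x).symm z)) = J.inChart x z v :=
    fun v z hz => rfl
  have c' : ∀ v : E, HasFDerivAt (fun _ : E => v) (0 : E →L[ℝ] E) (extChartAt 𝓘(ℝ, E) x x) :=
    fun v => hasFDerivAt_const v _
  have d' : ∀ v : E, HasFDerivAt (fun z : E => J.inChart x z v) ((J.deriv x).flip v)
      (extChartAt 𝓘(ℝ, E) x x) := fun v =>
    (ContinuousLinearMap.apply ℝ E v).hasFDerivAt.comp (extChartAt 𝓘(ℝ, E) x x)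
      (J.hasFDerivAt_inChart x)
  have b1 := mlieBracket_eq_of_hasFDerivAt (V := J.mulField fun y => frame x y X)
    (W := J.mulField fun y => frame x y Y) (d X) (d Y) (d' X) (d' Y)
  have b2 := mlieBracket_eq_of_hasFDerivAt (V := fun y => frame x y X)
    (W := J.mulField fun y => frame x y Y) (c X) (d Y) (c' X) (d' Y)
  have b3 := mlieBracket_eq_of_hasFDerivAt (V := J.mulField fun y => frame x y X)
    (W := fun y => frame x y Y) (d X) (c Y) (d' X) (c' Y)
  have b4 := mlieBracket_eq_of_hasFDerivAt (V := fun y => frame x y X)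
    (W := fun y => frame x y Y) (c X) (c Y) (c' X) (c' Y)
  have hl : nijenhuis J x X Y = nijenhuisAux J (fun y => frame x y X) (fun y => frame x y Y) x := by
    refine Eq.trans ?_ h
    rw [frame_self, frame_self]
    rfl
  rw [hl, nijenhuisAux, b1, b2, b3, b4, J.inChart_self]
  change _ - J.endo x _ - J.endo x _ - _ = _
  simp only [ContinuousLinearMap.flip_apply, zero_apply, sub_zero, zero_sub, map_neg]
  abel

/-- Differentiating `J² = -1` in a chart. -/
theorem AlmostComplexStructure.deriv_endo (J : AlmostComplexStructure E M) (x : M) (X Y : E) :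
    J.deriv x X (J.endo x Y) = -J.endo x (J.deriv x X Y) := by
  have h := (J.hasFDerivAt_inChart x).clm_comp (J.hasFDerivAt_inChart x)
  have hev : (fun z => (J.inChart x z).comp (J.inChart x z))
      =ᶠ[𝓝 (extChartAt 𝓘(ℝ, E) x x)] fun _ => -ContinuousLinearMap.id ℝ E := by
    filter_upwards [extChartAt_target_mem_nhds (I := 𝓘(ℝ, E)) x] with z hz
    have hs : (extChartAt 𝓘(ℝ, E) x).symm z ∈ (chartAt E x).source := by
      simpa using (extChartAt 𝓘(ℝ, E) x).map_target hz
    refine ContinuousLinearMap.ext fun v => ?_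
    have h1 := J.frame_inChart x hz v
    have h2 : J.inChart x z (J.inChart x z v) = coframe x ((extChartAt 𝓘(ℝ, E) x).symm z)
      (J _ (frame x ((extChartAt 𝓘(ℝ, E) x).symm z) (J.inChart x z v))) := rfl
    refine h2.trans ?_
    rw [h1, J.sq_eq_neg, map_neg, coframe_frame hs]
    rfl
  have h0 := h.unique ((hasFDerivAt_const _ _).congr_of_eventuallyEq hev)
  have h1 := congrArg (fun L : E →L[ℝ] E →L[ℝ] E => L X Y) h0
  rw [J.inChart_self] at h1
  refine eq_neg_of_add_eq_zero_right (Eq.trans ?_ h1)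
  rfl

/-- Follows termwise from the coordinate formula, because `J² = -1` and every `∂_X J` anticommutes
with `J`. -/
theorem nijenhuis_endo_right [FiniteDimensional ℝ E] (J : AlmostComplexStructure E M) (x : M)
    (X Y : E) :
    modelTensor (nijenhuis J x) X (J.endo x Y) =
      -J.endo x (modelTensor (nijenhuis J x) X Y) := by
  refine (nijenhuis_apply J x X (J.endo x Y)).trans ?_
  refine Eq.trans ?_ (congrArg (fun v => -J.endo x v) (nijenhuis_apply J x X Y)).symm
  simp only [map_add, map_sub, J.endo_endo, J.deriv_endo, map_neg, neg_apply]
  abel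

/-! ### The holomorphy criterion and the two lifts -/

/-- The condition on a `(1,2)`-tensor `R` for the fiberwise multiplication to be holomorphic with
respect to `J^c + γ(R)`. -/
theorem isHolomorphic_fiberMul_iff [FiniteDimensional ℝ E] (J : AlmostComplexStructure E M)
    (a : ℝ) {b : ℝ} (hb : b ≠ 0)
    (A : ∀ ξ : CotangentBundle E M,
      TangentSpace (cotangentModel E) ξ →L[ℝ] TangentSpace (cotangentModel E) ξ)
    (R : M → E →L[ℝ] E →L[ℝ] E)
    (hA : ∀ (ξ : CotangentBundle E M) (U : E × (E →L[ℝ] ℝ)), A ξ U = (J.endo ξ.proj U.1,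
      U.2.comp (J.endo ξ.proj) + (covector ξ).comp
        (J.deriv ξ.proj U.1 - (J.deriv ξ.proj).flip U.1 + R ξ.proj U.1))) :
    IsHolomorphic (cotangentModel E) (cotangentModel E) A A (fiberMul J a b) ↔
      ∀ (x : M) (X Y : E), J.endo x (R x X Y) - R x X (J.endo x Y) =
        modelTensor (nijenhuis J x) X Y := by
  -- The fibre component of `U` has dropped out of the right-hand condition, which only sees `U.1`
  -- and the covector.
  have key : ∀ (ξ : CotangentBundle E M) (U : E × (E →L[ℝ] ℝ)),
      (A (fiberMul J a b ξ)).comp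
          (mfderiv (cotangentModel E) (cotangentModel E) (fiberMul J a b) ξ) U =
        (mfderiv (cotangentModel E) (cotangentModel E) (fiberMul J a b) ξ).comp (A ξ) U ↔
      ∀ V : E, covector ξ (J.endo ξ.proj (R ξ.proj U.1 V) - R ξ.proj U.1 (J.endo ξ.proj V) -
        modelTensor (nijenhuis J ξ.proj) U.1 V) = 0 := by
    intro ξ U
    have l : (A (fiberMul J a b ξ)).comp
        (mfderiv (cotangentModel E) (cotangentModel E) (fiberMul J a b) ξ) U =
        ((J.endo ξ.proj U.1, (a • U.2 + b • ((covector ξ).comp (J.deriv ξ.proj U.1) +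
            U.2.comp (J.endo ξ.proj))).comp (J.endo ξ.proj) +
          (a • covector ξ + b • (covector ξ).comp (J.endo ξ.proj)).comp
            (J.deriv ξ.proj U.1 - (J.deriv ξ.proj).flip U.1 + R ξ.proj U.1)) :
              E × (E →L[ℝ] ℝ)) :=
      (congrArg (A (fiberMul J a b ξ)) (mfderiv_fiberMul_apply J a b ξ U)).trans
        (hA (fiberMul J a b ξ) _)
    have r : (mfderiv (cotangentModel E) (cotangentModel E) (fiberMul J a b) ξ).comp (A ξ) U =
        ((J.endo ξ.proj U.1, a • (U.2.comp (J.endo ξ.proj) + (covector ξ).comp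
            (J.deriv ξ.proj U.1 - (J.deriv ξ.proj).flip U.1 + R ξ.proj U.1)) +
          b • ((covector ξ).comp (J.deriv ξ.proj (J.endo ξ.proj U.1)) +
            (U.2.comp (J.endo ξ.proj) + (covector ξ).comp
            (J.deriv ξ.proj U.1 - (J.deriv ξ.proj).flip U.1 + R ξ.proj U.1)).comp
              (J.endo ξ.proj))) : E × (E →L[ℝ] ℝ)) :=
      (congrArg (mfderiv (cotangentModel E) (cotangentModel E) (fiberMul J a b) ξ) (hA ξ U)).trans
        (mfderiv_fiberMul_apply J a b ξ _)
    have n : ∀ V : E, modelTensor (nijenhuis J ξ.proj) U.1 V = _ :=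
      nijenhuis_apply J ξ.proj U.1
    have pe : ∀ (v : E) (p q : E →L[ℝ] ℝ), (v, p) = (v, q) ↔ ∀ V, p V = q V := fun v p q => by
      rw [Prod.mk_right_inj, ContinuousLinearMap.ext_iff]
    refine (iff_of_eq (congrArg₂ Eq l r)).trans ((pe _ _ _).trans (forall_congr' fun V => ?_))
    rw [← sub_eq_zero, n]
    -- The difference of the two covector components is `b` times the stated expression; here `b ≠
    -- 0` is needed.
    refine (Eq.congr ?_ rfl).trans (mul_eq_zero_iff_left hb)
    simp only [add_apply, sub_apply, smul_apply, ContinuousLinearMap.comp_apply,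
      ContinuousLinearMap.flip_apply, map_add, map_sub, smul_eq_mul]
    ring
  constructor
  · intro h x X Y
    refine sub_eq_zero.1 (by_contra fun hne => ?_)
    -- Holomorphy holds at every point over `x`, so it may be tested at a covector that detects the
    -- defect.
    obtain ⟨p, hp⟩ := SeparatingDual.exists_ne_zero (R := ℝ) hne
    refine hp ((key ⟨x, p⟩ (X, 0)).1 ?_ Y)
    exact congrArg (fun L : E × (E →L[ℝ] ℝ) →L[ℝ] E × (E →L[ℝ] ℝ) => L (X, 0)) (h.2 ⟨x, p⟩)
  · intro h
    refine ⟨contMDiff_fiberMul J a b, fun ξ => ContinuousLinearMap.ext fun U =>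
      (key ξ U).2 fun V => ?_⟩
    rw [h, sub_self, map_zero]

theorem completeLift_apply [FiniteDimensional ℝ E] (J : AlmostComplexStructure E M)
    (ξ : CotangentBundle E M) (U : E × (E →L[ℝ] ℝ)) :
    completeLift J ξ U = (J.endo ξ.proj U.1,
      U.2.comp (J.endo ξ.proj) + (covector ξ).comp
        (J.deriv ξ.proj U.1 - (J.deriv ξ.proj).flip U.1 +
          (-(1 / 2 : ℝ) • modelTensor (mulNijenhuis J ξ.proj)) U.1)) := by
  have e : completeLift J ξ U =
    liftC J ξ U - (1 / 2 : ℝ) • contraction (mulNijenhuis J) ξ U := rfl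
  rw [e, liftC_apply, contraction_apply]
  refine Prod.ext ?_ (ContinuousLinearMap.ext fun V => ?_)
  · change J.endo ξ.proj U.1 - (1 / 2 : ℝ) • (0 : E) = J.endo ξ.proj U.1
    rw [smul_zero, sub_zero]
  · change U.2 (J.endo ξ.proj V) + covector ξ (J.deriv ξ.proj U.1 V - J.deriv ξ.proj V U.1) -
      (1 / 2 : ℝ) * covector ξ (modelTensor (mulNijenhuis J ξ.proj) U.1 V) =
      U.2 (J.endo ξ.proj V) + covector ξ (J.deriv ξ.proj U.1 V - J.deriv ξ.proj V U.1 +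
        -(1 / 2 : ℝ) • modelTensor (mulNijenhuis J ξ.proj) U.1 V)
    rw [map_add, map_smul, smul_eq_mul]
    ring

theorem horizontalLift_apply [FiniteDimensional ℝ E]
    (cov : CovariantDerivative 𝓘(ℝ, E) E (TangentSpace 𝓘(ℝ, E) : M → Type _))
    (J : AlmostComplexStructure E M) (ξ : CotangentBundle E M) (U : E × (E →L[ℝ] ℝ)) :
    horizontalLift cov J ξ U = (J.endo ξ.proj U.1,
      U.2.comp (J.endo ξ.proj) + (covector ξ).comp
        (J.deriv ξ.proj U.1 - (J.deriv ξ.proj).flip U.1 +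
          modelTensor (bracketNablaJ (symmetrize cov) J ξ.proj) U.1)) := by
  have e : horizontalLift cov J ξ U =
    liftC J ξ U + contraction (bracketNablaJ (symmetrize cov) J) ξ U := rfl
  rw [e, liftC_apply, contraction_apply]
  refine Prod.ext ?_ (ContinuousLinearMap.ext fun V => ?_)
  · exact add_zero (J.endo ξ.proj U.1)
  · refine Eq.trans (add_assoc (U.2 (J.endo ξ.proj V)) _ _) ?_
    exact congrArg (fun t => U.2 (J.endo ξ.proj V) + t) (map_add (covector ξ) _ _).symm

/-! ### Covariant derivatives of `J` and the symmetrised connection -/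

variable [FiniteDimensional ℝ E]

theorem nablaJ_apply (cov : CovariantDerivative 𝓘(ℝ, E) E (TangentSpace 𝓘(ℝ, E) : M → Type _))
    (J : AlmostComplexStructure E M) {x : M} {Y : ∀ x : M, TangentSpace 𝓘(ℝ, E) x}
    (hY : MDiffAt (T% Y) x) (v : TangentSpace 𝓘(ℝ, E) x) :
    nablaJ cov J x v (Y x) = cov (J.mulField Y) x v - J x (cov Y x v) :=
  congrArg (fun L : TangentSpace 𝓘(ℝ, E) x →L[ℝ] TangentSpace 𝓘(ℝ, E) x => L v)
    (TensorialAt.mkHom_apply (nablaJAux_tensorial cov J x) hY)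

omit [FiniteDimensional ℝ E] in
theorem mulField_mulField (J : AlmostComplexStructure E M)
    (Y : ∀ x : M, TangentSpace 𝓘(ℝ, E) x) :
    J.mulField (J.mulField Y) = (-1 : ℝ) • Y := by
  funext x
  rw [Pi.smul_apply, neg_one_smul]
  exact J.sq_eq_neg x (Y x)

omit [FiniteDimensional ℝ E] in
theorem exists_mdifferentiableAt_eq (x : M) (v : TangentSpace 𝓘(ℝ, E) x) :
    ∃ V : ∀ y : M, TangentSpace 𝓘(ℝ, E) y, MDiffAt (T% V) x ∧ V x = v :=
  ⟨fun y => frame (E := E) x y v, mdifferentiableAt_frame (E := E) x v, frame_self (E := E) x v⟩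

/-- Apply the definition to the field `JY` and use `J(JY) = -Y`: `-∇_X Y - J∇_X(JY) = -J(∇_X(JY) -
J∇_X Y)`. -/
theorem nablaJ_endo_right
    (cov : CovariantDerivative 𝓘(ℝ, E) E (TangentSpace 𝓘(ℝ, E) : M → Type _))
    (J : AlmostComplexStructure E M) (x : M) (X Y : TangentSpace 𝓘(ℝ, E) x) :
    nablaJ cov J x X (J x Y) = -J x (nablaJ cov J x X Y) := by
  obtain ⟨Y, hY, rfl⟩ := exists_mdifferentiableAt_eq x Y
  have h := nablaJ_apply cov J (J.mdifferentiableAt_mulField hY) X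
  rw [mulField_mulField, cov.isCovariantDerivativeOnUniv.smul_const (-1) hY] at h
  rw [nablaJ_apply cov J hY, map_sub, J.sq_eq_neg]
  refine h.trans ?_
  rw [smul_apply]
  module

/-- `∇̃` is torsion free: by antisymmetry the two half-torsions add up to the whole torsion of `∇`.
-/
theorem symmetrize_sub_symmetrize
    (cov : CovariantDerivative 𝓘(ℝ, E) E (TangentSpace 𝓘(ℝ, E) : M → Type _)) {x : M}
    {X Y : ∀ x : M, TangentSpace 𝓘(ℝ, E) x} (hX : MDiffAt (T% X) x) (hY : MDiffAt (T% Y) x) :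
    symmetrize cov Y x (X x) - symmetrize cov X x (Y x) = mlieBracket 𝓘(ℝ, E) X Y x := by
  have e : ∀ (X : ∀ x : M, TangentSpace 𝓘(ℝ, E) x) (v : TangentSpace 𝓘(ℝ, E) x),
      symmetrize cov X x v = cov X x v + -((1 / 2 : ℝ) • cov.torsion x v (X x)) :=
    fun X v => rfl
  have h := cov.torsion_apply hX hY
  rw [e, e, cov.torsion_antisymm (Y x) (X x), h]
  module

/-- The Nijenhuis tensor in terms of the torsion-free connection `∇̃`. -/
theorem nijenhuis_eq_nablaJ_symmetrize
    (cov : CovariantDerivative 𝓘(ℝ, E) E (TangentSpace 𝓘(ℝ, E) : M → Type _))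
    (J : AlmostComplexStructure E M) (x : M) (X Y : TangentSpace 𝓘(ℝ, E) x) :
    nijenhuis J x X Y = nablaJ (symmetrize cov) J x (J x X) Y
      - nablaJ (symmetrize cov) J x (J x Y) X - J x (nablaJ (symmetrize cov) J x X Y)
      + J x (nablaJ (symmetrize cov) J x Y X) := by
  obtain ⟨X, hX, rfl⟩ := exists_mdifferentiableAt_eq x X
  obtain ⟨Y, hY, rfl⟩ := exists_mdifferentiableAt_eq x Y
  have hJX := J.mdifferentiableAt_mulField hX
  have hJY := J.mdifferentiableAt_mulField hY
  have h : nijenhuis J x (X x) (Y x) = nijenhuisAux J X Y x :=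
    TensorialAt.mkHom₂_apply (Φ := fun X Y => nijenhuisAux J X Y x)
      (fun Y _ => nijenhuisAux_tensorial_left J x Y)
      (fun X _ => nijenhuisAux_tensorial_right J x X) hX hY
  -- Each bracket becomes `∇̃_X Y - ∇̃_Y X`; after `J² = -1` the terms regroup into values of `∇̃J`.
  rw [nijenhuisAux, ← symmetrize_sub_symmetrize cov hJX hJY,
    ← symmetrize_sub_symmetrize cov hX hJY, ← symmetrize_sub_symmetrize cov hJX hY,
    ← symmetrize_sub_symmetrize cov hX hY] at h
  rw [nablaJ_apply _ J hX, nablaJ_apply _ J hX, nablaJ_apply _ J hY, nablaJ_apply _ J hY, h]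
  simp only [AlmostComplexStructure.mulField, map_sub, J.sq_eq_neg]
  module

end AlmostComplex

/-! ### The theorem -/

theorem corollary3 {E : Type*} [NormedAddCommGroup E] [NormedSpace ℝ E] [FiniteDimensional ℝ E]
    {M : Type*} [TopologicalSpace M] [ChartedSpace E M] [IsManifold 𝓘(ℝ, E) ∞ M]
    (J : AlmostComplex.AlmostComplexStructure E M) (a b : ℝ) (hb : b ≠ 0) :
    AlmostComplex.IsHolomorphic (AlmostComplex.cotangentModel E) (AlmostComplex.cotangentModel E)
      (AlmostComplex.completeLift J) (AlmostComplex.completeLift J)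
      (AlmostComplex.fiberMul J a b) ∧
    ∀ cov : CovariantDerivative 𝓘(ℝ, E) E (TangentSpace 𝓘(ℝ, E) : M → Type _),
      AlmostComplex.IsHolomorphic (AlmostComplex.cotangentModel E) (AlmostComplex.cotangentModel E)
        (AlmostComplex.horizontalLift cov J) (AlmostComplex.horizontalLift cov J)
        (AlmostComplex.fiberMul J a b) ↔
      ∀ (x : M) (X Y : TangentSpace 𝓘(ℝ, E) x),
        AlmostComplex.nablaJ (AlmostComplex.symmetrize cov) J x (J x X) Y =
          AlmostComplex.nablaJ (AlmostComplex.symmetrize cov) J x X (J x Y) := by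
  constructor
  · refine (AlmostComplex.isHolomorphic_fiberMul_iff J a hb _
      (fun x => -(1 / 2 : ℝ) • AlmostComplex.modelTensor (AlmostComplex.mulNijenhuis J x))
      (AlmostComplex.completeLift_apply J)).2 fun x X Y => ?_
    change J.endo x (-(1 / 2 : ℝ) • J.endo x
        (AlmostComplex.modelTensor (AlmostComplex.nijenhuis J x) X Y)) -
      -(1 / 2 : ℝ) • J.endo x
        (AlmostComplex.modelTensor (AlmostComplex.nijenhuis J x) X (J.endo x Y)) = _
    -- With `R = -½ J N_J`, `J R(X,Y) = ½ N_J(X,Y)` and `R(X,JY) = -½ N_J(X,Y)`.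
    rw [AlmostComplex.nijenhuis_endo_right, map_smul, map_neg, J.endo_endo]
    module
  · intro cov
    refine (AlmostComplex.isHolomorphic_fiberMul_iff J a hb _
      (fun x => AlmostComplex.modelTensor
        (AlmostComplex.bracketNablaJ (AlmostComplex.symmetrize cov) J x))
      (AlmostComplex.horizontalLift_apply cov J)).trans ?_
    refine forall_congr' fun x => forall_congr' fun X => forall_congr' fun Y => ?_
    have hN := AlmostComplex.nijenhuis_eq_nablaJ_symmetrize cov J x X Y
    have h1 := AlmostComplex.nablaJ_endo_right (AlmostComplex.symmetrize cov) J x X Y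
    set S := AlmostComplex.nablaJ (AlmostComplex.symmetrize cov) J x with hS
    change J x (-S X Y + S Y X) - (-S X (J x Y) + S (J x Y) X) = AlmostComplex.nijenhuis J x X Y ↔
      S (J x X) Y = S X (J x Y)
    -- Both equations are turned into vanishing differences. The symmetry swap fixes the sign, so
    -- that each difference is the same vector `-J S(X,Y) - S(JX,Y)`.
    rw [hN, h1, map_add, map_neg, ← sub_eq_zero, eq_comm (a := S (J x X) Y),
      ← sub_eq_zero (b := S (J x X) Y)]
    refine Eq.congr ?_ rfl
    module
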